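/- Let $N\ge 2$ and let $f:\mathbb R\to\mathbb R$ be a continuous function such that $$\liminf_{t\to-\infty} f(t)>0$$ (the value $+\infty$ being allowed). Solutions are understood in the weak $C^1$ sense: $u\in C^1(\mathbb R^N)$ is a solution of $$-\operatorname{div}\left(\frac{\nabla u}{\sqrt{1+|\nabla u|^2}}\right)\ge f(u)\quad\text{on }\mathbb R^N \qquad (1)$$ if $$\int_{\mathbb R^N}\frac{\nabla u\cdot\nabla\varphi}{\sqrt{1+|\nabla u|^2}}\,dx\ \ge\ \int_{\mathbb R^N} f(u)\,\varphi\,dx$$ for every nonnegative compactly supported $\varphi\in C^1(\mathbb R^N)$, and it is a solution of $$-\operatorname{div}\left(\frac{\nabla u}{\sqrt{1+|\nabla u|^2}}\right)= f(u)\quad\text{on }\mathbb R^N \qquad (2)$$ if equality holds for every compactly supported $\varphi\in C^1(\mathbb R^N)$. Let $S:=f^{-1}(0)$. (i) If $u$ is a solution of (1), then $S$ is nonempty, $\alpha:=\min S$ exists, and $u(x)\ge\alpha$ for all $x\in\mathbb R^N$. (ii) In particular, if $f(t)>0$ for all $t\in\mathbb R$, then (1) has no solution. (iii) If moreover $$\limsup_{t\to+\infty}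 f(t)<0$$ (the value $-\infty$ being allowed) and $u$ is a solution of (2), then $\alpha:=\min S$ and $\beta:=\max S$ exist, $u$ is bounded, and $\alpha\le u(x)\le\beta$ for all $x\in\mathbb R^N$. -/

import Mathlib

open Filter MeasureTheory Topology

/-- Test functions: `C¹` functions on `ℝ^N` with compact support. -/
structure IsTestFunction {N : ℕ} (φ : EuclideanSpace ℝ (Fin N) → ℝ) : Prop where
  contDiff : ContDiff ℝ 1 φ
  hasCompactSupport : HasCompactSupport φ

/-- The vector field `∇u / √(1 + |∇u|²)`, whose divergence is the mean curvature operator. -/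
noncomputable def meanCurvatureField {N : ℕ} (u : EuclideanSpace ℝ (Fin N) → ℝ)
    (x : EuclideanSpace ℝ (Fin N)) : EuclideanSpace ℝ (Fin N) :=
  (1 / Real.sqrt (1 + ‖gradient u x‖ ^ 2)) • gradient u x

/-- `u` is a weak `C¹` solution of `-div (∇u / √(1 + |∇u|²)) ≥ f(u)` on `ℝ^N`. -/
structure IsMeanCurvatureInequalitySolution {N : ℕ} (f : ℝ → ℝ)
    (u : EuclideanSpace ℝ (Fin N) → ℝ) : Prop where
  contDiff : ContDiff ℝ 1 u
  weak : ∀ φ : EuclideanSpace ℝ (Fin N) → ℝ, IsTestFunction φ → (∀ x, 0 ≤ φ x) →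
    ∫ x, f (u x) * φ x ≤ ∫ x, inner ℝ (meanCurvatureField u x) (gradient φ x)

/-- `u` is a weak `C¹` solution of `-div (∇u / √(1 + |∇u|²)) = f(u)` on `ℝ^N`. -/
structure IsMeanCurvatureEquationSolution {N : ℕ} (f : ℝ → ℝ)
    (u : EuclideanSpace ℝ (Fin N) → ℝ) : Prop where
  contDiff : ContDiff ℝ 1 u
  weak : ∀ φ : EuclideanSpace ℝ (Fin N) → ℝ, IsTestFunction φ →
    ∫ x, inner ℝ (meanCurvatureField u x) (gradient φ x) = ∫ x, f (u x) * φ x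

/-! The field `∇u / √(1 + |∇u|²)` has norm at most 1, whatever the size of `∇u`. If `f ≥ c > 0` on
`(-∞, t]`, testing with `ψ(t - u) χ` gives `c ∫ ψ(t - u) χ ≤ ∫ ψ(t - u) |∇χ|`, because the term with
`ψ'` has a favourable sign. Taking for `χ` powers of a cutoff at scale `R`, each use gains `1/R`,
and enough uses beat the volume growth `R^N`; so `ψ(t - u) = 0`, i.e. `u ≥ t` (`le_of_forall_le`).
Below its zeros `f` is positive, so `t` can be pushed up to `min S`; the upper bound follows by
reflection `u ↦ -u`. -/

section LiouvilleEstimate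

variable {N : ℕ}

theorem norm_meanCurvatureField_le_one (u : EuclideanSpace ℝ (Fin N) → ℝ)
    (x : EuclideanSpace ℝ (Fin N)) : ‖meanCurvatureField u x‖ ≤ 1 := by
  have hpos : 0 < Real.sqrt (1 + ‖gradient u x‖ ^ 2) := Real.sqrt_pos.2 (by positivity)
  rw [meanCurvatureField, norm_smul, Real.norm_of_nonneg (by positivity), one_div,
    inv_mul_le_iff₀ hpos, mul_one]
  exact Real.le_sqrt_of_sq_le (by linarith)

theorem ContDiff.continuous_gradient {u : EuclideanSpace ℝ (Fin N) → ℝ} (hu : ContDiff ℝ 1 u) :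
    Continuous (gradient u) :=
  (InnerProductSpace.toDual ℝ (EuclideanSpace ℝ (Fin N))).symm.continuous.comp
    (hu.continuous_fderiv one_ne_zero)

theorem continuous_meanCurvatureField {u : EuclideanSpace ℝ (Fin N) → ℝ}
    (hu : ContDiff ℝ 1 u) : Continuous (meanCurvatureField u) := by
  have hg := hu.continuous_gradient
  refine Continuous.smul (Continuous.div continuous_const
    (continuous_const.add (hg.norm.pow 2)).sqrt fun x => ?_) hg
  exact (Real.sqrt_pos.2 (add_pos_of_pos_of_nonneg one_pos (sq_nonneg ‖gradient u x‖))).ne'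

theorem fderiv_apply_meanCurvatureField_nonneg (u : EuclideanSpace ℝ (Fin N) → ℝ)
    (x : EuclideanSpace ℝ (Fin N)) : 0 ≤ fderiv ℝ u x (meanCurvatureField u x) := by
  rw [← inner_gradient_left, meanCurvatureField, real_inner_smul_right]
  exact mul_nonneg (by positivity) real_inner_self_nonneg

theorem inner_gradient_eq_fderiv (φ : EuclideanSpace ℝ (Fin N) → ℝ)
    (v x : EuclideanSpace ℝ (Fin N)) : inner ℝ v (gradient φ x) = fderiv ℝ φ x v := by
  rw [real_inner_comm, inner_gradient_left]

theorem gradient_neg_fun (u : EuclideanSpace ℝ (Fin N) → ℝ) (x : EuclideanSpace ℝ (Fin N)) :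
    gradient (fun y => -u y) x = -gradient u x := by
  simp [gradient, fderiv_fun_neg]

theorem meanCurvatureField_neg (u : EuclideanSpace ℝ (Fin N) → ℝ)
    (x : EuclideanSpace ℝ (Fin N)) :
    meanCurvatureField (fun y => -u y) x = -meanCurvatureField u x := by
  simp [meanCurvatureField, gradient_neg_fun]

theorem IsTestFunction.integrable_mul {φ g : EuclideanSpace ℝ (Fin N) → ℝ}
    (hφ : IsTestFunction φ) (hg : Continuous g) : Integrable fun x => g x * φ x :=
  (hg.mul hφ.contDiff.continuous).integrable_of_hasCompactSupport
    hφ.hasCompactSupport.mul_left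

theorem IsTestFunction.integrable_mul_norm_fderiv {φ g : EuclideanSpace ℝ (Fin N) → ℝ}
    (hφ : IsTestFunction φ) (hg : Continuous g) :
    Integrable fun x => g x * ‖fderiv ℝ φ x‖ :=
  (hg.mul (hφ.contDiff.continuous_fderiv one_ne_zero).norm).integrable_of_hasCompactSupport
    (hφ.hasCompactSupport.fderiv ℝ).norm.mul_left

theorem IsTestFunction.integrable_inner {φ : EuclideanSpace ℝ (Fin N) → ℝ}
    {F : EuclideanSpace ℝ (Fin N) → EuclideanSpace ℝ (Fin N)}
    (hφ : IsTestFunction φ) (hF : Continuous F) :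
    Integrable fun x => inner ℝ (F x) (gradient φ x) := by
  simp only [inner_gradient_eq_fderiv]
  refine ((hφ.contDiff.continuous_fderiv one_ne_zero).clm_apply hF).integrable_of_hasCompactSupport
    ((hφ.hasCompactSupport.fderiv ℝ).mono fun x hx => ?_)
  contrapose! hx
  simp only [Function.mem_support, not_not] at hx ⊢
  simp [hx]

/-! ### Integral estimates on the set `u < t` -/

/-- Testing with `ψ (t - u) * χ` for a smooth monotone `ψ` vanishing on the negative axis. -/
theorem IsMeanCurvatureInequalitySolution.mul_integral_le {f : ℝ → ℝ} (hf : Continuous f)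
    {u : EuclideanSpace ℝ (Fin N) → ℝ} (hu : IsMeanCurvatureInequalitySolution f u)
    {c t : ℝ} (hft : ∀ s ≤ t, c ≤ f s) {χ : EuclideanSpace ℝ (Fin N) → ℝ}
    (hχ : IsTestFunction χ) (hχ0 : ∀ x, 0 ≤ χ x) :
    c * ∫ x, Real.smoothTransition (t - u x) * χ x ≤
      ∫ x, Real.smoothTransition (t - u x) * ‖fderiv ℝ χ x‖ := by
  set v : EuclideanSpace ℝ (Fin N) → ℝ := fun x => Real.smoothTransition (t - u x) with hv
  have hψ : ContDiff ℝ 1 Real.smoothTransition := Real.smoothTransition.contDiff (n := 1)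
  have hvC : ContDiff ℝ 1 v := hψ.comp (contDiff_const.sub hu.contDiff)
  have hv0 : ∀ x, 0 ≤ v x := fun x => Real.smoothTransition.nonneg _
  have hφ : IsTestFunction fun x => v x * χ x :=
    ⟨hvC.mul hχ.contDiff, hχ.hasCompactSupport.mul_left⟩
  have hweak := hu.weak _ hφ fun x => mul_nonneg (hv0 x) (hχ0 x)
  have hvderiv : ∀ x, fderiv ℝ v x = -(deriv Real.smoothTransition (t - u x) • fderiv ℝ u x) := by
    intro x
    have hd := (hu.contDiff.differentiable one_ne_zero x).hasFDerivAt.const_sub t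
    have hs := (hψ.differentiable one_ne_zero (t - u x)).hasDerivAt
    exact (hs.comp_hasFDerivAt x hd).fderiv.trans (smul_neg _ _)
  calc c * ∫ x, v x * χ x = ∫ x, c * (v x * χ x) := (integral_const_mul _ _).symm
    _ ≤ ∫ x, f (u x) * (v x * χ x) := by
        refine integral_mono ((hχ.integrable_mul hvC.continuous).const_mul c)
          (hφ.integrable_mul (hf.comp hu.contDiff.continuous)) fun x => ?_
        rcases le_or_gt (u x) t with h | h
        · exact mul_le_mul_of_nonneg_right (hft _ h) (mul_nonneg (hv0 x) (hχ0 x))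
        · have : v x = 0 := Real.smoothTransition.zero_of_nonpos (by linarith)
          simp [this]
    _ ≤ ∫ x, inner ℝ (meanCurvatureField u x) (gradient (fun x => v x * χ x) x) := hweak
    _ ≤ ∫ x, v x * ‖fderiv ℝ χ x‖ := by
        refine integral_mono (hφ.integrable_inner (continuous_meanCurvatureField hu.contDiff))
          (hχ.integrable_mul_norm_fderiv hvC.continuous) fun x => ?_
        simp only [inner_gradient_eq_fderiv]
        rw [fderiv_fun_mul (hvC.differentiable one_ne_zero x)
          (hχ.contDiff.differentiable one_ne_zero x), hvderiv]
        simp only [add_apply, smul_apply, neg_apply, smul_eq_mul]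
        -- The derivative falling on `v` contributes minus this quantity, so it can be dropped.
        have h1 : 0 ≤ χ x * (deriv Real.smoothTransition (t - u x) *
            fderiv ℝ u x (meanCurvatureField u x)) :=
          mul_nonneg (hχ0 x) (mul_nonneg Real.smoothTransition.monotone.deriv_nonneg
            (fderiv_apply_meanCurvatureField_nonneg u x))
        have h2 : fderiv ℝ χ x (meanCurvatureField u x) ≤ ‖fderiv ℝ χ x‖ :=
          (le_abs_self _).trans <| ((fderiv ℝ χ x).le_opNorm _).trans <|
            mul_le_of_le_one_right (norm_nonneg _) (norm_meanCurvatureField_le_one u x)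
        have h3 := mul_le_mul_of_nonneg_left h2 (hv0 x)
        linarith

theorem IsTestFunction.comp_inv_smul_pow {η : EuclideanSpace ℝ (Fin N) → ℝ}
    (hη : IsTestFunction η) {R : ℝ} (hR : 0 < R) (k : ℕ) :
    IsTestFunction fun x => η (R⁻¹ • x) ^ (k + 1) where
  contDiff := (hη.contDiff.comp (contDiff_const_smul R⁻¹)).pow _
  hasCompactSupport := by
    have h := hη.hasCompactSupport.comp_smul (inv_ne_zero hR.ne')
    refine h.mono fun x hx => ?_
    contrapose! hx
    simp only [Function.mem_support, not_not] at hx ⊢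
    simp [hx]

/-- Differentiation costs one power of the cutoff and gains `1 / R`, which is what makes the
estimate iterable. -/
theorem IsTestFunction.norm_fderiv_comp_inv_smul_pow_le {η : EuclideanSpace ℝ (Fin N) → ℝ}
    (hη : IsTestFunction η) (hη0 : ∀ x, 0 ≤ η x) {M : ℝ} (hM : ∀ x, ‖fderiv ℝ η x‖ ≤ M)
    {R : ℝ} (hR : 0 < R) (k : ℕ) (x : EuclideanSpace ℝ (Fin N)) :
    ‖fderiv ℝ (fun x => η (R⁻¹ • x) ^ (k + 1)) x‖ ≤
      (k + 1) * M / R * η (R⁻¹ • x) ^ k := by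
  have h1 : HasFDerivAt (fun x : EuclideanSpace ℝ (Fin N) => R⁻¹ • x)
      (R⁻¹ • ContinuousLinearMap.id ℝ _) x := (hasFDerivAt_id x).const_smul R⁻¹
  have h2 := ((hη.contDiff.differentiable one_ne_zero (R⁻¹ • x)).hasFDerivAt.comp x h1).pow (k + 1)
  refine (congrArg norm h2.fderiv).trans_le ?_
  simp only [ContinuousLinearMap.comp_smul, ContinuousLinearMap.comp_id, norm_smul, norm_mul,
    norm_pow, Function.comp_apply, Real.norm_of_nonneg (hη0 _), Nat.add_sub_cancel, nsmul_eq_mul,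
    Real.norm_of_nonneg (inv_nonneg.2 hR.le), Nat.cast_add, Nat.cast_one]
  rw [Real.norm_of_nonneg (by positivity)]
  have h3 : 0 ≤ ((k : ℝ) + 1) * η (R⁻¹ • x) ^ k * R⁻¹ := by
    have := hη0 (R⁻¹ • x)
    positivity
  calc _ = ((k : ℝ) + 1) * η (R⁻¹ • x) ^ k * R⁻¹ * ‖fderiv ℝ η (R⁻¹ • x)‖ := by ring
    _ ≤ ((k : ℝ) + 1) * η (R⁻¹ • x) ^ k * R⁻¹ * M := mul_le_mul_of_nonneg_left (hM _) h3
    _ = _ := by ring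

/-- Since the mean curvature field is bounded, each power of the cutoff gains a factor `1 / R`. -/
theorem IsMeanCurvatureInequalitySolution.integral_cutoff_pow_le {f : ℝ → ℝ} (hf : Continuous f)
    {u : EuclideanSpace ℝ (Fin N) → ℝ} (hu : IsMeanCurvatureInequalitySolution f u)
    {c t : ℝ} (hc : 0 < c) (hft : ∀ s ≤ t, c ≤ f s) {η : EuclideanSpace ℝ (Fin N) → ℝ}
    (hη : IsTestFunction η) (hη0 : ∀ x, 0 ≤ η x) (k : ℕ) :
    ∃ C : ℝ, ∀ R : ℝ, 0 < R →
      ∫ x, Real.smoothTransition (t - u x) * η (R⁻¹ • x) ^ (k + 1) ≤ C * R ^ N / R ^ k := by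
  have hvcont : Continuous fun x => Real.smoothTransition (t - u x) :=
    Real.smoothTransition.continuous.comp (continuous_const.sub hu.contDiff.continuous)
  induction k with
  | zero =>
    -- Since `ψ ≤ 1`, rescaling the integral of `η` yields the factor `R ^ N`.
    refine ⟨∫ x, η x, fun R hR => ?_⟩
    have hχ := hη.comp_inv_smul_pow hR 0
    have h := Measure.integral_comp_inv_smul_of_nonneg volume η hR.le
    rw [finrank_euclideanSpace_fin, smul_eq_mul] at h
    rw [pow_zero, div_one, mul_comm, ← h]
    refine integral_mono (hχ.integrable_mul hvcont) ?_ fun x => ?_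
    · simpa using hχ.integrable_mul (g := fun _ => 1) continuous_const
    · simpa using mul_le_of_le_one_left (hη0 (R⁻¹ • x)) (Real.smoothTransition.le_one (t - u x))
  | succ k ih =>
    obtain ⟨C, hC⟩ := ih
    obtain ⟨M, hM⟩ := (hη.contDiff.continuous_fderiv one_ne_zero).bounded_above_of_compact_support
      (hη.hasCompactSupport.fderiv ℝ)
    have hM0 : 0 ≤ M := (norm_nonneg _).trans (hM 0)
    refine ⟨((k + 1 : ℕ) + 1) * M / c * C, fun R hR => ?_⟩
    have hχ := hη.comp_inv_smul_pow hR (k + 1)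
    have h1 := hu.mul_integral_le hf hft hχ fun x => pow_nonneg (hη0 _) _
    have h2 : ∫ x, Real.smoothTransition (t - u x) *
        ‖fderiv ℝ (fun x => η (R⁻¹ • x) ^ (k + 1 + 1)) x‖ ≤
        ((k + 1 : ℕ) + 1) * M / R *
          ∫ x, Real.smoothTransition (t - u x) * η (R⁻¹ • x) ^ (k + 1) := by
      rw [← integral_const_mul]
      refine integral_mono (hχ.integrable_mul_norm_fderiv hvcont)
        (((hη.comp_inv_smul_pow hR k).integrable_mul hvcont).const_mul _) fun x => ?_
      have := mul_le_mul_of_nonneg_left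
        (hη.norm_fderiv_comp_inv_smul_pow_le hη0 hM hR (k + 1) x)
        (Real.smoothTransition.nonneg (t - u x))
      refine this.trans_eq (by ring)
    have h3 : ((k + 1 : ℕ) + 1) * M / R *
          ∫ x, Real.smoothTransition (t - u x) * η (R⁻¹ • x) ^ (k + 1) ≤
        ((k + 1 : ℕ) + 1) * M / R * (C * R ^ N / R ^ k) :=
      mul_le_mul_of_nonneg_left (hC R hR) (by positivity)
    calc _ ≤ (((k + 1 : ℕ) + 1) * M / R * (C * R ^ N / R ^ k)) / c := by
          rw [le_div_iff₀' hc]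
          exact (h1.trans h2).trans h3
      _ = _ := by field_simp; ring

/-- A solution of the inequality cannot enter a half-line on which `f` is bounded below by a
positive constant. -/
theorem IsMeanCurvatureInequalitySolution.le_of_forall_le {f : ℝ → ℝ} (hf : Continuous f)
    {u : EuclideanSpace ℝ (Fin N) → ℝ} (hu : IsMeanCurvatureInequalitySolution f u)
    {c t : ℝ} (hc : 0 < c) (hft : ∀ s ≤ t, c ≤ f s) (x₀ : EuclideanSpace ℝ (Fin N)) :
    t ≤ u x₀ := by
  by_contra! hx₀
  have hvcont : Continuous fun x => Real.smoothTransition (t - u x) :=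
    Real.smoothTransition.continuous.comp (continuous_const.sub hu.contDiff.continuous)
  let η : ContDiffBump (0 : EuclideanSpace ℝ (Fin N)) := ⟨1, 2, one_pos, one_lt_two⟩
  let b : ContDiffBump x₀ := ⟨1 / 2, 1, by norm_num, by norm_num⟩
  have hη : IsTestFunction η := ⟨η.contDiff, η.hasCompactSupport⟩
  have hb : IsTestFunction b := ⟨b.contDiff, b.hasCompactSupport⟩
  -- The exponent `N + 1` exceeds the volume growth by one, leaving `C / R`.
  obtain ⟨C, hC⟩ := hu.integral_cutoff_pow_le hf hc hft hη (fun x => η.nonneg) (N + 1)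
  have hpos : 0 < ∫ x, Real.smoothTransition (t - u x) * b x := by
    refine (hvcont.mul b.continuous).integral_pos_of_hasCompactSupport_nonneg_nonzero
      hb.hasCompactSupport.mul_left (fun x => mul_nonneg (Real.smoothTransition.nonneg _) b.nonneg)
      (x := x₀) ?_
    exact (mul_pos (Real.smoothTransition.pos_of_pos (by linarith))
      (b.pos_of_mem_ball (Metric.mem_ball_self b.rOut_pos))).ne'
  -- For such `R` the rescaled cutoff equals 1 on the unit ball about `x₀`, outside which `b`
  -- vanishes.
  have hle : ∀ R : ℝ, ‖x₀‖ + 1 ≤ R → ∫ x, Real.smoothTransition (t - u x) * b x ≤ C * R⁻¹ := by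
    intro R hR
    have hR0 : 0 < R := by linarith [norm_nonneg x₀]
    have h : C * R ^ N / R ^ (N + 1) = C * R⁻¹ := by field_simp; ring
    rw [← h]
    refine (integral_mono (hb.integrable_mul hvcont)
      ((hη.comp_inv_smul_pow hR0 (N + 1)).integrable_mul hvcont) fun x => ?_).trans (hC R hR0)
    refine mul_le_mul_of_nonneg_left ?_ (Real.smoothTransition.nonneg _)
    rcases le_or_gt 1 (dist x x₀) with hx | hx
    · rw [b.zero_of_le_dist hx]
      exact pow_nonneg η.nonneg _
    · have : η (R⁻¹ • x) = 1 := by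
        refine η.one_of_mem_closedBall ?_
        rw [mem_closedBall_zero_iff, norm_smul, Real.norm_of_nonneg (inv_nonneg.2 hR0.le),
          inv_mul_le_iff₀ hR0]
        have h4 : ‖x‖ ≤ ‖x - x₀‖ + ‖x₀‖ := by simpa using norm_add_le (x - x₀) x₀
        rw [dist_eq_norm] at hx
        change ‖x‖ ≤ R * 1
        linarith
      rw [this, one_pow]
      exact b.le_one
  have hlim : Tendsto (fun R : ℝ => C * R⁻¹) atTop (𝓝 0) := by
    simpa using tendsto_inv_atTop_zero.const_mul C
  exact hpos.not_ge (ge_of_tendsto hlim ((eventually_ge_atTop _).mono hle))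

/-! ### Behaviour of `f` at infinity and its zero set -/

theorem exists_pos_forall_le_of_liminf_pos {f : ℝ → ℝ}
    (hinf : 0 < liminf (fun t : ℝ => (f t : EReal)) atBot) :
    ∃ c > 0, ∃ T : ℝ, ∀ s ≤ T, c ≤ f s := by
  obtain ⟨c, hc0, hc⟩ := EReal.lt_iff_exists_real_btwn.1 hinf
  obtain ⟨T, hT⟩ := eventually_atBot.1 (eventually_lt_of_lt_liminf hc)
  exact ⟨c, by exact_mod_cast hc0, T, fun s hs => by exact_mod_cast (hT s hs).le⟩

theorem exists_pos_forall_le_neg_of_limsup_neg {f : ℝ → ℝ}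
    (hsup : limsup (fun t : ℝ => (f t : EReal)) atTop < 0) :
    ∃ c > 0, ∃ T : ℝ, ∀ s ≥ T, f s ≤ -c := by
  obtain ⟨c, hc, hc0⟩ := EReal.lt_iff_exists_real_btwn.1 hsup
  obtain ⟨T, hT⟩ := eventually_atTop.1 (eventually_lt_of_limsup_lt hc)
  refine ⟨-c, by simpa using (by exact_mod_cast hc0 : c < 0), T, fun s hs => ?_⟩
  rw [neg_neg]
  exact_mod_cast (hT s hs).le

theorem exists_pos_forall_le_of_pos {f : ℝ → ℝ} (hf : Continuous f) {c T t : ℝ} (hc : 0 < c)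
    (hT : ∀ s ≤ T, c ≤ f s) (hpos : ∀ s ≤ t, 0 < f s) : ∃ c' > 0, ∀ s ≤ t, c' ≤ f s := by
  obtain ⟨m, hm0, hm⟩ : ∃ m > 0, ∀ s ∈ Set.Icc T t, m ≤ f s := by
    rcases (Set.Icc T t).eq_empty_or_nonempty with h | h
    · exact ⟨1, one_pos, by simp [h]⟩
    · obtain ⟨s, hs, hmin⟩ := isCompact_Icc.exists_isMinOn h hf.continuousOn
      exact ⟨f s, hpos s hs.2, fun r hr => hmin hr⟩
  refine ⟨min c m, lt_min hc hm0, fun s hs => ?_⟩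
  rcases le_total s T with h | h
  · exact (min_le_left _ _).trans (hT s h)
  · exact (min_le_right _ _).trans (hm s ⟨h, hs⟩)

theorem IsMeanCurvatureInequalitySolution.exists_isLeast {f : ℝ → ℝ} (hf : Continuous f)
    {c T : ℝ} (hc : 0 < c) (hT : ∀ s ≤ T, c ≤ f s)
    {u : EuclideanSpace ℝ (Fin N) → ℝ} (hu : IsMeanCurvatureInequalitySolution f u) :
    ∃ α : ℝ, IsLeast (f ⁻¹' {0}) α ∧ ∀ x, α ≤ u x := by
  have key : ∀ t, (∀ s ≤ t, f s ≠ 0) → ∀ x, t ≤ u x := by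
    intro t ht x
    have hpos : ∀ s ≤ t, 0 < f s := by
      intro s hs
      by_contra! h
      have hT0 : 0 < f (min T s) := hc.trans_le (hT _ (min_le_left _ _))
      obtain ⟨r, hr, hr0⟩ := intermediate_value_Icc' (min_le_right T s) hf.continuousOn
        ⟨h, hT0.le⟩
      exact ht r (hr.2.trans hs) hr0
    obtain ⟨c', hc', h⟩ := exists_pos_forall_le_of_pos hf hc hT hpos
    exact hu.le_of_forall_le hf hc' h x
  have hne : (f ⁻¹' {0}).Nonempty := by
    by_contra h
    -- Without zeros, `key` applies at every level, even one above `u 0`.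
    have := key (u 0 + 1) (fun s _ hs => h ⟨s, hs⟩) 0
    linarith
  have hbdd : BddBelow (f ⁻¹' {0}) :=
    ⟨T, fun s (hs : f s = 0) => by
      by_contra! h
      linarith [hT s h.le]⟩
  refine ⟨sInf (f ⁻¹' {0}), (isClosed_singleton.preimage hf).isLeast_csInf hne hbdd, fun x => ?_⟩
  refine le_of_forall_lt fun t ht => ?_
  -- `key` gives only a weak inequality; the intermediate level makes `t < u x` strict.
  obtain ⟨t', ht', ht''⟩ := exists_between ht
  exact ht'.trans_le (key t' (fun s hs h0 => (csInf_le hbdd h0).not_gt (hs.trans_lt ht'')) x)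

theorem IsMeanCurvatureEquationSolution.toInequality {f : ℝ → ℝ}
    {u : EuclideanSpace ℝ (Fin N) → ℝ} (hu : IsMeanCurvatureEquationSolution f u) :
    IsMeanCurvatureInequalitySolution f u :=
  ⟨hu.contDiff, fun φ hφ _ => (hu.weak φ hφ).ge⟩

theorem IsMeanCurvatureEquationSolution.neg {f : ℝ → ℝ}
    {u : EuclideanSpace ℝ (Fin N) → ℝ} (hu : IsMeanCurvatureEquationSolution f u) :
    IsMeanCurvatureEquationSolution (fun t => -f (-t)) fun x => -u x where
  contDiff := hu.contDiff.neg
  weak φ hφ := by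
    simp only [meanCurvatureField_neg, inner_neg_left, neg_neg, neg_mul, integral_neg,
      hu.weak φ hφ]

end LiouvilleEstimate

theorem mainTheorem5 (N : ℕ) (hN : 2 ≤ N) (f : ℝ → ℝ) (hf : Continuous f)
    (hinf : 0 < liminf (fun t : ℝ => (f t : EReal)) atBot) :
    (∀ u : EuclideanSpace ℝ (Fin N) → ℝ, IsMeanCurvatureInequalitySolution f u →
      ∃ α : ℝ, IsLeast (f ⁻¹' {0}) α ∧ ∀ x, α ≤ u x) ∧
    ((∀ t, 0 < f t) →
      ¬ ∃ u : EuclideanSpace ℝ (Fin N) → ℝ, IsMeanCurvatureInequalitySolution f u) ∧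
    (limsup (fun t : ℝ => (f t : EReal)) atTop < 0 →
      ∀ u : EuclideanSpace ℝ (Fin N) → ℝ, IsMeanCurvatureEquationSolution f u →
        Bornology.IsBounded (Set.range u) ∧
        ∃ α β : ℝ, IsLeast (f ⁻¹' {0}) α ∧ IsGreatest (f ⁻¹' {0}) β ∧
          ∀ x, α ≤ u x ∧ u x ≤ β) := by
  obtain ⟨c, hc, T, hT⟩ := exists_pos_forall_le_of_liminf_pos hinf
  refine ⟨fun u hu => hu.exists_isLeast hf hc hT, ?_, fun hsup u hu => ?_⟩
  · rintro hpos ⟨u, hu⟩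
    obtain ⟨α, hα, -⟩ := hu.exists_isLeast hf hc hT
    exact (hpos α).ne' hα.1
  · obtain ⟨d, hd, T', hT'⟩ := exists_pos_forall_le_neg_of_limsup_neg hsup
    obtain ⟨α, hα, hαu⟩ := hu.toInequality.exists_isLeast hf hc hT
    -- The zeros of `t ↦ -f (-t)` are the negatives of those of `f`, so `-γ` is the greatest zero of
    -- `f`.
    obtain ⟨γ, hγ, hγu⟩ := hu.neg.toInequality.exists_isLeast (T := -T')
      (hf.comp continuous_neg).neg hd fun s hs => le_neg.1 (hT' (-s) (by linarith))
    have hbd : ∀ x, α ≤ u x ∧ u x ≤ -γ := fun x => ⟨hαu x, by linarith [hγu x]⟩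
    refine ⟨(Metric.isBounded_Icc α (-γ)).subset (Set.range_subset_iff.2 hbd), α, -γ, hα,
      ⟨?_, fun s hs => ?_⟩, hbd⟩
    · have h : -f (-γ) = 0 := hγ.1
      exact neg_eq_zero.1 h
    · have h : -f (-(-s)) = 0 := by rw [neg_neg, neg_eq_zero]; exact hs
      linarith [hγ.2 h]
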